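/- All theories are first-order theories with equality. A theory $V$ is a definitional extension of a theory $U$ if the signature of $V$ extends that of $U$, $V$ and $U$ prove the same sentences of the signature of $U$, for every predicate symbol $P$ of $V$ there is a formula $\mathsf D_P(\vec x)$ of the signature of $U$ with $V\vdash\forall\vec x\,(P(\vec x)\leftrightarrow \mathsf D_P(\vec x))$, and for every function symbol $f$ of $V$ there is a formula $\mathsf D_f(\vec x,y)$ of the signature of $U$ with $V\vdash\forall\vec x\,\forall y\,(f(\vec x)=y\leftrightarrow \mathsf D_f(\vec x,y))$. Theories $T$ and $U$ are definitionally equivalent if, after renaming their symbols so that their signatures are disjoint, they have a joint definitional extension $V$; given such a $V$, the $U$-model corresponding to a $T$-model $M$ is obtained by expanding $M$ to a model of $V$ on the same domain (there is exactly one such expansion) and restricting the result to the signature of $U$. A computable model of a finite signature is a model whose domain is a computable set of natural numbers and in which all function and predicate symbols are interpreted by computable functions and computable sets of tuples. True arithmetic is the set of all sentences of the signature $(0,1,+,\times)$ that hold in $\mathbb N$. **Theorem.** Let $T$ be a theory in a finite signature that is definitionally equivalent to true arithmetic, let $V$ be any joint definitional extension of $T$ and true arithmetic, and let $M$ be a computable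 model of $T$. Then the arithmetical model $M'$ corresponding to $M$ via $V$ is not non-standard, i.e. $M'$ is isomorphic to the standard model $\mathbb N$. -/

import Mathlib

open FirstOrder FirstOrder.Language

universe u₁ v₁ u₂ v₂ u₃ v₃ w

namespace DefEquiv

/-- The function symbols `0`, `1`, `+`, `×` of the arithmetical signature. -/
inductive ArithFunc : ℕ → Type
  | zero : ArithFunc 0
  | one : ArithFunc 0
  | add : ArithFunc 2
  | mul : ArithFunc 2

/-- The arithmetical signature `(0, 1, +, ×)`. -/
def arith : FirstOrder.Language.{0, 0} where
  Functions := ArithFunc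
  Relations := fun _ => Empty

/-- The standard model of arithmetic. -/
instance standardModel : arith.Structure ℕ where
  funMap := fun {_} f x =>
    match f, x with
    | ArithFunc.zero, _ => 0
    | ArithFunc.one, _ => 1
    | ArithFunc.add, x => x 0 + x 1
    | ArithFunc.mul, x => x 0 * x 1
  RelMap := fun {_} R _ => Empty.elim R

/-- True arithmetic: all arithmetical sentences that hold in the standard model. -/
def trueArithmetic : arith.Theory :=
  arith.completeTheory ℕ

/-- An arithmetical structure is non-standard if it is not isomorphic to the standard model. -/
def IsNonstandard {M : Type*} (S : arith.Structure M) : Prop :=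
  letI := S
  IsEmpty (M ≃[arith] ℕ)

/-- `V` is a definitional extension of `T`, where the signature `L` of `T` is regarded as a part of
the signature `L'` of `V` by means of the map `i`.  Derivability from a theory is expressed by
`⊨ᵇ` (truth in all nonempty models, under all assignments to the free variables), which by the
completeness theorem is the same thing. -/
structure IsDefinitionalExtension {L : FirstOrder.Language.{u₁, v₁}} {L' : FirstOrder.Language.{u₂, v₂}}
    (i : L →ᴸ L') (T : L.Theory) (V : L'.Theory) : Prop where
  /-- the signature of `V` extends the signature of `T` -/
  injective : i.Injective
  /-- `V` and `T` prove the same sentences of the signature of `T` -/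
  conservative : ∀ φ : L.Sentence, V ⊨ᵇ i.onSentence φ ↔ T ⊨ᵇ φ
  /-- `V ⊢ ∀ x, P(x) ↔ D(x)` for some formula `D` of the signature of `T` -/
  relation_definable : ∀ (n : ℕ) (P : L'.Relations n), ∃ D : L.Formula (Fin n),
    V ⊨ᵇ (P.formula fun k => Term.var k).iff (i.onFormula D)
  /-- `V ⊢ ∀ x y, y = f(x) ↔ D(y, x)` for some formula `D` of the signature of `T`; the variable
  with index `0` is `y` -/
  function_definable : ∀ (n : ℕ) (f : L'.Functions n), ∃ D : L.Formula (Fin (n + 1)),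
    V ⊨ᵇ (Formula.graph f).iff (i.onFormula D)

/-- `V` is a joint definitional extension of `T₁` and `T₂`, their signatures having been renamed by
`i` and `j` to disjoint parts of the signature of `V`.  Thus `T₁` and `T₂` are definitionally
equivalent if and only if there are `L`, `i`, `j` and `V` of this kind. -/
structure IsJointDefinitionalExtension {L₁ : FirstOrder.Language.{u₁, v₁}} {L₂ : FirstOrder.Language.{u₂, v₂}}
    {L : FirstOrder.Language.{u₃, v₃}} (i : L₁ →ᴸ L) (j : L₂ →ᴸ L)
    (T₁ : L₁.Theory) (T₂ : L₂.Theory) (V : L.Theory) : Prop where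
  left : IsDefinitionalExtension i T₁ V
  right : IsDefinitionalExtension j T₂ V
  disjoint_functions : ∀ (n : ℕ) (f : L₁.Functions n) (g : L₂.Functions n),
    i.onFunction f ≠ j.onFunction g
  disjoint_relations : ∀ (n : ℕ) (P : L₁.Relations n) (Q : L₂.Relations n),
    i.onRelation P ≠ j.onRelation Q

/-- The structures `S₁` and `S₂` on the same domain `M` correspond to each other with respect to
the joint definitional extension `V`: they are the restrictions to the two signatures of one model
of `V` on `M`. -/
def Corresponds {L₁ : FirstOrder.Language.{u₁, v₁}} {L₂ : FirstOrder.Language.{u₂, v₂}} {L : FirstOrder.Language.{u₃, v₃}}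
    (i : L₁ →ᴸ L) (j : L₂ →ᴸ L) (V : L.Theory) {M : Type w}
    (S₁ : L₁.Structure M) (S₂ : L₂.Structure M) : Prop :=
  ∃ S : L.Structure M, M ⊨ V ∧ i.reduct M = S₁ ∧ j.reduct M = S₂

/-- A structure whose domain is a set `D` of natural numbers is computable if `D` is a computable
set and all functions and predicates of the signature are interpreted by computable functions and
computable sets of tuples.  (A function on tuples from the computable set `D` is computable iff it
is the restriction of a total computable function.) -/
structure IsComputableStructure {L : FirstOrder.Language.{u₁, v₁}} {D : Set ℕ} (S : L.Structure D) :
    Prop where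
  domain : ComputablePred fun x : ℕ => x ∈ D
  functions : ∀ (n : ℕ) (f : L.Functions n), ∃ g : (Fin n → ℕ) → ℕ, Computable g ∧
    ∀ x : Fin n → D, g (fun k => (x k : ℕ)) = (S.funMap f x : ℕ)
  relations : ∀ (n : ℕ) (P : L.Relations n), ComputablePred fun x : Fin n → ℕ =>
    ∃ h : ∀ k, x k ∈ D, S.RelMap P fun k => ⟨x k, h k⟩

end DefEquiv

namespace DefEquiv

/-! The argument is a diagonalisation inside arithmetic. Computable functions and sets are
arithmetical, so `M` is arithmetical; `M'` is first-order definable in `M` on the same domain, so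
satisfaction in `M'` of any fixed formula is arithmetical too
(`IsArithmeticalStructure.of_definable`, `exists_formula`), and so is the map sending `n` to its
numeral in `M'`.

If `M'` were non-standard, one formula `E` would code every arithmetical set: each is `{n | M' ⊨
E(n, a)}` for some element `a`, with `n` read as a numeral (`exists_uniform_coding`). But elements
of `M'` are themselves natural numbers, so `{n | not M' ⊨ E(n, n)}`, the second `n` being read as an
element, is arithmetical. A code `a` of this set gives a contradiction at `n = a`. -/

/-- A relation on natural numbers, with arguments indexed by `α`, is arithmetical if it is defined
by a formula in the standard model. -/
def Arithmetical {α : Type} (P : (α → ℕ) → Prop) : Prop :=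
  ∃ φ : arith.Formula α, ∀ v, φ.Realize v ↔ P v

/-- A function on natural numbers is arithmetical if its graph is. -/
def ArithmeticalFun {α : Type} (f : (α → ℕ) → ℕ) : Prop :=
  Arithmetical fun w : Option α → ℕ => w none = f (w ∘ some)

/-! ### Closure properties of arithmetical relations -/

namespace Arithmetical

variable {α β : Type} {P Q : (α → ℕ) → Prop}

theorem of_iff (h : Arithmetical P) (e : ∀ v, Q v ↔ P v) : Arithmetical Q := by
  obtain ⟨φ, hφ⟩ := h
  exact ⟨φ, fun v => (hφ v).trans (e v).symm⟩

theorem not (h : Arithmetical P) : Arithmetical fun v => ¬ P v := by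
  obtain ⟨φ, hφ⟩ := h
  exact ⟨φ.not, fun v => by rw [Formula.realize_not, hφ]⟩

theorem imp (hP : Arithmetical P) (hQ : Arithmetical Q) : Arithmetical fun v => P v → Q v := by
  obtain ⟨φ, hφ⟩ := hP
  obtain ⟨ψ, hψ⟩ := hQ
  exact ⟨φ.imp ψ, fun v => by rw [Formula.realize_imp, hφ, hψ]⟩

theorem and (hP : Arithmetical P) (hQ : Arithmetical Q) : Arithmetical fun v => P v ∧ Q v :=
  (hP.imp hQ.not).not.of_iff fun v => by tauto

theorem reindex (h : Arithmetical P) (g : α → β) : Arithmetical fun v : β → ℕ => P (v ∘ g) := by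
  obtain ⟨φ, hφ⟩ := h
  exact ⟨φ.relabel g, fun v => by rw [Formula.realize_relabel, hφ]⟩

theorem forall_finite {ι : Type} [Finite ι] {P : ι → (α → ℕ) → Prop}
    (h : ∀ i, Arithmetical (P i)) : Arithmetical fun v => ∀ i, P i v := by
  choose φ hφ using h
  exact ⟨Formula.iInf φ, fun v => by simp only [Formula.realize_iInf, hφ]⟩

theorem exists_tuple [Finite β] {P : (α → ℕ) → (β → ℕ) → Prop}
    (h : Arithmetical fun w : α ⊕ β → ℕ => P (w ∘ Sum.inl) (w ∘ Sum.inr)) :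
    Arithmetical fun v => ∃ y, P v y := by
  obtain ⟨φ, hφ⟩ := h
  refine ⟨φ.iExs β, fun v => ?_⟩
  simp only [Formula.realize_iExs, hφ, Sum.elim_comp_inl, Sum.elim_comp_inr]

theorem exists_nat {P : (α → ℕ) → ℕ → Prop}
    (h : Arithmetical fun w : Option α → ℕ => P (w ∘ some) (w none)) :
    Arithmetical fun v => ∃ y, P v y := by
  have h' : Arithmetical fun v => ∃ y : Unit → ℕ, P v (y ()) :=
    exists_tuple (h.reindex fun a : Option α => a.elim (Sum.inr ()) Sum.inl)
  exact h'.of_iff fun v => ⟨fun ⟨y, hy⟩ => ⟨fun _ => y, hy⟩, fun ⟨y, hy⟩ => ⟨y (), hy⟩⟩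

theorem forall_nat {P : (α → ℕ) → ℕ → Prop}
    (h : Arithmetical fun w : Option α → ℕ => P (w ∘ some) (w none)) :
    Arithmetical fun v => ∀ y, P v y :=
  (exists_nat (P := fun v y => ¬ P v y) h.not).not.of_iff fun v => by simp

/-- Only graphs are available, so the values `f a v` are named by an existentially quantified tuple.
-/
theorem subst [Finite α] (h : Arithmetical P) {f : α → (β → ℕ) → ℕ}
    (hf : ∀ a, ArithmeticalFun (f a)) : Arithmetical fun v => P fun a => f a v := by
  have h' : Arithmetical fun v : β → ℕ => ∃ y : α → ℕ, (∀ a, y a = f a v) ∧ P y :=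
    exists_tuple <| .and
      (.forall_finite fun a => (hf a).reindex fun b : Option β => b.elim (Sum.inr a) Sum.inl)
      (h.reindex Sum.inr)
  refine h'.of_iff fun v => ⟨fun hv => ⟨_, fun _ => rfl, hv⟩, fun ⟨y, hy, hv⟩ => ?_⟩
  rwa [← funext hy]

end Arithmetical

/-! ### Closure properties of arithmetical functions -/

namespace ArithmeticalFun

variable {α β : Type} {f g : (α → ℕ) → ℕ}

theorem realize (t : arith.Term α) : ArithmeticalFun fun v => t.realize v :=
  ⟨(Term.var none).equal (t.relabel some), fun v => by
    simp [Formula.realize_equal, Term.realize_relabel]⟩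

theorem var (a : α) : ArithmeticalFun fun v : α → ℕ => v a :=
  realize (Term.var a)

theorem comp [Finite α] {F : (α → ℕ) → ℕ} (hF : ArithmeticalFun F) {f : α → (β → ℕ) → ℕ}
    (hf : ∀ a, ArithmeticalFun (f a)) : ArithmeticalFun fun v => F fun a => f a v := by
  refine Arithmetical.subst (f := fun a : Option α => fun w : Option β → ℕ =>
    a.elim (w none) fun a => f a (w ∘ some)) hF fun a => ?_
  cases a with
  | none => exact var none
  | some a =>
    exact (hf a).reindex fun b : Option β => b.elim none (some ∘ some)

theorem reindex (h : ArithmeticalFun f) (g : α → β) : ArithmeticalFun fun v : β → ℕ => f (v ∘ g) :=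
  Arithmetical.reindex h (Option.map g)

theorem congr (h : ArithmeticalFun f) (e : ∀ v, g v = f v) : ArithmeticalFun g :=
  (funext e : g = f) ▸ h

theorem zero : ArithmeticalFun fun _ : α → ℕ => 0 :=
  (realize (Term.func (L := arith) ArithFunc.zero Fin.elim0)).congr fun _ => rfl

theorem one : ArithmeticalFun fun _ : α → ℕ => 1 :=
  (realize (Term.func (L := arith) ArithFunc.one Fin.elim0)).congr fun _ => rfl

theorem add (hf : ArithmeticalFun f) (hg : ArithmeticalFun g) :
    ArithmeticalFun fun v => f v + g v :=
  comp (f := ![f, g])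
    (realize (Term.func (L := arith) ArithFunc.add fun i : Fin 2 => Term.var i))
    (by intro a; fin_cases a <;> assumption)

theorem mul (hf : ArithmeticalFun f) (hg : ArithmeticalFun g) :
    ArithmeticalFun fun v => f v * g v :=
  comp (f := ![f, g])
    (realize (Term.func (L := arith) ArithFunc.mul fun i : Fin 2 => Term.var i))
    (by intro a; fin_cases a <;> assumption)

theorem eq (hf : ArithmeticalFun f) (hg : ArithmeticalFun g) :
    Arithmetical fun v => f v = g v := by
  have h : Arithmetical fun v => ∃ y, y = f v ∧ y = g v := .exists_nat (hf.and hg)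
  exact h.of_iff fun v => by simp

theorem lt (hf : ArithmeticalFun f) (hg : ArithmeticalFun g) :
    Arithmetical fun v => f v < g v := by
  have h : Arithmetical fun v => ∃ y, f v + y + 1 = g v :=
    .exists_nat (eq (((hf.reindex some).add (var none)).add one) (hg.reindex some))
  exact h.of_iff fun v => ⟨fun h => ⟨g v - f v - 1, by lia⟩, fun ⟨y, hy⟩ => by lia⟩

theorem mod (hf : ArithmeticalFun f) (hg : ArithmeticalFun g) (hpos : ∀ v, 0 < g v) :
    ArithmeticalFun fun v => f v % g v := by
  have h : Arithmetical fun w : Option α → ℕ =>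
      ∃ q, w none < g (w ∘ some) ∧ w none + g (w ∘ some) * q = f (w ∘ some) :=
    .exists_nat <| .and (lt (var (some none)) (hg.reindex (some ∘ some)))
      (eq (add (var (some none)) (mul (hg.reindex (some ∘ some)) (var none)))
        (hf.reindex (some ∘ some)))
  refine h.of_iff fun w => ⟨fun e => ⟨f (w ∘ some) / g (w ∘ some), ?_, ?_⟩, fun ⟨q, hq, e⟩ => ?_⟩
  · exact e ▸ Nat.mod_lt _ (hpos _)
  · rw [e, Nat.mod_add_div]
  · change _ = f (w ∘ some) % g (w ∘ some)
    rw [← e, Nat.add_mul_mod_self_left, Nat.mod_eq_of_lt hq]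

end ArithmeticalFun

theorem Arithmetical.forall_lt {α : Type} {f : (α → ℕ) → ℕ} {P : (α → ℕ) → ℕ → Prop}
    (hf : ArithmeticalFun f)
    (h : Arithmetical fun w : Option α → ℕ => P (w ∘ some) (w none)) :
    Arithmetical fun v => ∀ y < f v, P v y :=
  .forall_nat (.imp (ArithmeticalFun.lt (.var none) (hf.reindex some)) h)

/-! ### Gödel's beta function and recursion -/

/-- Every finite initial segment of a sequence is given by remainders modulo the terms of an
arithmetic progression. -/
theorem exists_mod_eq (s : ℕ → ℕ) (n : ℕ) : ∃ a b, ∀ i ≤ n, a % ((i + 1) * b + 1) = s i := by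
  let l := (List.range (n + 1)).map s
  refine ⟨(Nat.unbeta l).unpair.1, (Nat.unbeta l).unpair.2, fun i hi => ?_⟩
  have := Nat.beta_unbeta_coe l ⟨i, by simp [l]; lia⟩
  simpa [Nat.beta, l] using this

/-- The recursion is replaced by the existence of a beta-coded sequence of its successive values. -/
theorem ArithmeticalFun.natRec {α : Type} [Finite α] {f : (α → ℕ) → ℕ} {g : (α → ℕ) → ℕ → ℕ → ℕ}
    (hf : ArithmeticalFun f)
    (hg : ArithmeticalFun fun w : Option (Option α) → ℕ =>
      g (w ∘ some ∘ some) (w (some none)) (w none)) :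
    ArithmeticalFun fun w : Option α → ℕ =>
      Nat.rec (motive := fun _ => ℕ) (f (w ∘ some)) (g (w ∘ some)) (w none) := by
  have hb : ∀ {β : Type} {a b i : (β → ℕ) → ℕ}, ArithmeticalFun a → ArithmeticalFun b →
      ArithmeticalFun i → ArithmeticalFun fun v => a v % ((i v + 1) * b v + 1) :=
    fun ha hb hi => ha.mod (((hi.add .one).mul hb).add .one) fun _ => Nat.succ_pos _
  have hg' : ∀ {β : Type} {x : α → β} {a b : (β → ℕ) → ℕ}, ArithmeticalFun a →
      ArithmeticalFun b → ArithmeticalFun fun v => g (v ∘ x) (a v) (b v) := by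
    intro β x a b ha hb
    refine ArithmeticalFun.comp (f := fun o : Option (Option α) =>
      o.elim b fun o => o.elim a fun i v => v (x i)) hg fun o => ?_
    rcases o with _ | _ | i
    exacts [hb, ha, .var _]
  -- Here `u none` is the output and `u (some none)` the recursion argument; `a, b` code the
  -- computation.
  have h : Arithmetical fun u : Option (Option α) → ℕ => ∃ a b,
      a % ((0 + 1) * b + 1) = f (u ∘ some ∘ some) ∧
      (∀ i < u (some none), a % ((i + 1 + 1) * b + 1) =
        g (u ∘ some ∘ some) i (a % ((i + 1) * b + 1))) ∧
      a % ((u (some none) + 1) * b + 1) = u none := by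
    refine .exists_nat <| .exists_nat <| .and ?_ <| .and ?_ ?_
    · exact ArithmeticalFun.eq (hb (.var (some none)) (.var none) .zero)
        (hf.reindex (some ∘ some ∘ some ∘ some))
    · exact .forall_lt (.var (some (some (some none))))
        (ArithmeticalFun.eq (hb (.var (some (some none))) (.var (some none)) (.add (.var none) .one))
          (hg' (.var none) (hb (.var (some (some none))) (.var (some none)) (.var none))))
    · exact ArithmeticalFun.eq (hb (.var (some none)) (.var none) (.var (some (some (some none)))))
        (.var (some (some none)))
  refine h.of_iff fun u => ?_
  constructor
  · intro hu
    obtain ⟨a, b, hab⟩ := exists_mod_eq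
      (Nat.rec (f (u ∘ some ∘ some)) (g (u ∘ some ∘ some))) (u (some none))
    refine ⟨a, b, hab 0 (Nat.zero_le _), fun i hi => ?_, (hab _ le_rfl).trans hu.symm⟩
    rw [hab (i + 1) hi, hab i hi.le]
  · rintro ⟨a, b, h0, hs, hu⟩
    have key : ∀ i ≤ u (some none), a % ((i + 1) * b + 1) =
        Nat.rec (motive := fun _ => ℕ) (f (u ∘ some ∘ some)) (g (u ∘ some ∘ some)) i := by
      intro i
      induction i with
      | zero => exact fun _ => h0
      | succ i ih => exact fun hi => by rw [hs i hi, ih (Nat.le_of_succ_le hi)]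
    rw [← hu]
    exact key _ le_rfl

/-! ### Computable functions and sets are arithmetical -/

theorem ArithmeticalFun.of_primrec' {n : ℕ} {f : List.Vector ℕ n → ℕ} (h : Nat.Primrec' f) :
    ArithmeticalFun fun v : Fin n → ℕ => f (List.Vector.ofFn v) := by
  induction h with
  | zero => exact .zero
  | succ => exact (ArithmeticalFun.var 0).add .one
  | get i => exact (ArithmeticalFun.var i).congr fun v => by simp
  | comp g _ _ hf hg => exact ArithmeticalFun.comp hf hg
  | @prec n f g _ _ hf hg =>
    have h := ArithmeticalFun.natRec (g := fun v y z => g (y ::ᵥ z ::ᵥ List.Vector.ofFn v)) hf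
      (hg.reindex (Fin.cons (some none) (Fin.cons none (some ∘ some)) :
        Fin (n + 2) → Option (Option (Fin n))))
    exact h.reindex fun o : Option (Fin n) => o.elim 0 Fin.succ

theorem mem_mOfFn {n : ℕ} {f : Fin n → Part ℕ} {x : Fin n → ℕ} :
    List.Vector.ofFn x ∈ List.Vector.mOfFn f ↔ ∀ i, x i ∈ f i := by
  induction n with
  | zero => simp [List.Vector.mOfFn, List.Vector.ofFn, pure]
  | succ n ih =>
    rw [Fin.forall_fin_succ, ← ih (f := fun i => f i.succ) (x := fun i => x i.succ)]
    simp only [List.Vector.mOfFn, List.Vector.ofFn, Part.bind_eq_bind, Part.mem_bind_iff,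
      Part.pure_eq_some, Part.mem_some_iff]
    constructor
    · rintro ⟨a, ha, b, hb, e⟩
      have e1 := congrArg List.Vector.head e
      have e2 := congrArg List.Vector.tail e
      simp only [List.Vector.head_cons, List.Vector.tail_cons] at e1 e2
      exact ⟨e1 ▸ ha, e2 ▸ hb⟩
    · rintro ⟨ha, hb⟩
      exact ⟨_, ha, _, hb, rfl⟩

/-- Working with the graph makes undefined values harmless in the induction. -/
theorem Arithmetical.of_partrec' {n : ℕ} {f : List.Vector ℕ n →. ℕ} (h : Nat.Partrec' f) :
    Arithmetical fun w : Option (Fin n) → ℕ => w none ∈ f (List.Vector.ofFn (w ∘ some)) := by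
  induction h with
  | prim h =>
    exact (ArithmeticalFun.of_primrec' h).of_iff fun w => by simp
  | @comp m n f g _ _ hf hg =>
    have h : Arithmetical fun w : Option (Fin m) → ℕ => ∃ y : Fin n → ℕ,
        (∀ i, y i ∈ g i (List.Vector.ofFn (w ∘ some))) ∧ w none ∈ f (List.Vector.ofFn y) := by
      refine .exists_tuple (.and (.forall_finite fun i => ?_) ?_)
      · exact (hg i).reindex fun o : Option (Fin m) => o.elim (Sum.inr i) (Sum.inl ∘ some)
      · exact hf.reindex fun o : Option (Fin n) => o.elim (Sum.inl none) Sum.inr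
    refine h.of_iff fun w => Part.mem_bind_iff.trans ⟨?_, ?_⟩
    · rintro ⟨a, ha, hw⟩
      rw [← List.Vector.ofFn_get a] at ha hw
      exact ⟨_, mem_mOfFn.1 ha, hw⟩
    · rintro ⟨y, hy, hw⟩
      exact ⟨_, mem_mOfFn.2 hy, hw⟩
  | @rfind n f _ hf =>
    have hf' : ArithmeticalFun fun v : Option (Fin n) → ℕ =>
        f (v none ::ᵥ List.Vector.ofFn (v ∘ some)) := by
      have : ArithmeticalFun fun v : Fin (n + 1) → ℕ => f (List.Vector.ofFn v) :=
        hf.of_iff fun w => by simp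
      exact this.reindex (Fin.cons none some : Fin (n + 1) → Option (Fin n))
    have h : Arithmetical fun w : Option (Fin n) → ℕ =>
        f (w none ::ᵥ List.Vector.ofFn (w ∘ some)) = 0 ∧
          ∀ y < w none, ¬ f (y ::ᵥ List.Vector.ofFn (w ∘ some)) = 0 := by
      refine .and (hf'.eq .zero) (.forall_lt (.var none) (.not (ArithmeticalFun.eq ?_ .zero)))
      exact hf'.reindex fun o : Option (Fin n) => o.elim none (some ∘ some)
    refine h.of_iff fun w => Nat.mem_rfind.trans ?_
    simp

theorem ArithmeticalFun.of_computable {n : ℕ} {f : (Fin n → ℕ) → ℕ} (h : Computable f) :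
    ArithmeticalFun f := by
  have hc : Computable fun v : List.Vector ℕ n => f v.get :=
    h.comp (Primrec.vector_get'.to_comp)
  have := Arithmetical.of_partrec' (Nat.Partrec'.of_part hc.partrec)
  refine this.of_iff fun w => ?_
  have e : (List.Vector.ofFn (w ∘ some)).get = w ∘ some := funext fun i => by simp
  simp [e]

theorem Arithmetical.of_computablePred {n : ℕ} {P : (Fin n → ℕ) → Prop} (h : ComputablePred P) :
    Arithmetical P := by
  obtain ⟨_, hP⟩ := h
  have hf : ArithmeticalFun fun v => if P v then 1 else 0 :=
    .of_computable ((Computable.cond hP (.const 1) (.const 0)).of_eq fun v => by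
      by_cases h : P v <;> simp [h])
  exact (hf.eq .one).of_iff fun v => by simp

/-! ### Definability over arithmetical structures -/

/-- A structure on a set of natural numbers is arithmetical if its domain is arithmetical and its
functions and relations are restrictions of arithmetical ones. -/
structure IsArithmeticalStructure {L : FirstOrder.Language.{u₁, v₁}} {D : Set ℕ}
    (S : L.Structure D) : Prop where
  domain : Arithmetical fun v : Unit → ℕ => v () ∈ D
  functions : ∀ {n : ℕ} (f : L.Functions n), ∃ F : (Fin n → ℕ) → ℕ, ArithmeticalFun F ∧
    ∀ x : Fin n → D, F (fun k => x k) = S.funMap f x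
  relations : ∀ {n : ℕ} (R : L.Relations n), ∃ P : (Fin n → ℕ) → Prop, Arithmetical P ∧
    ∀ x : Fin n → D, P (fun k => x k) ↔ S.RelMap R x

theorem IsComputableStructure.isArithmeticalStructure {L : FirstOrder.Language.{u₁, v₁}}
    {D : Set ℕ} {S : L.Structure D} (h : IsComputableStructure S) : IsArithmeticalStructure S where
  domain := by
    obtain ⟨_, hD⟩ := h.domain
    have : ComputablePred fun v : Fin 1 → ℕ => v 0 ∈ D :=
      ⟨fun v => inferInstance, hD.comp (Primrec.fin_app.comp .id (.const 0)).to_comp⟩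
    exact (Arithmetical.of_computablePred this).reindex fun _ => ()
  functions f :=
    let ⟨g, hg, e⟩ := h.functions _ f
    ⟨g, .of_computable hg, e⟩
  relations R := ⟨_, .of_computablePred (h.relations _ R), fun x => by simp⟩

namespace IsArithmeticalStructure

variable {L : FirstOrder.Language.{u₁, v₁}} {D : Set ℕ} {S : L.Structure D}

theorem exists_term (h : IsArithmeticalStructure S) {α : Type} (t : L.Term α) :
    ∃ F : (α → ℕ) → ℕ, ArithmeticalFun F ∧ ∀ x : α → D, F (fun a => x a) = t.realize x := by
  induction t with
  | var a => exact ⟨_, .var a, fun _ => rfl⟩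
  | func f ts ih =>
    choose G hG e using ih
    obtain ⟨F, hF, eF⟩ := h.functions f
    exact ⟨_, hF.comp hG, fun x => by simp only [e, eF, Term.realize]⟩

/-- Quantifiers are relativised to the arithmetical set `D`; outside `D` nothing is claimed about
`P`. -/
theorem exists_boundedFormula (h : IsArithmeticalStructure S) {α : Type} {n : ℕ}
    (φ : L.BoundedFormula α n) :
    ∃ P : (α ⊕ Fin n → ℕ) → Prop, Arithmetical P ∧
      ∀ x : α ⊕ Fin n → D, P (fun a => x a) ↔ φ.Realize (x ∘ Sum.inl) (x ∘ Sum.inr) := by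
  induction φ with
  | falsum => exact ⟨fun _ => False, ⟨⊥, fun v => by simp⟩, fun x => Iff.rfl⟩
  | equal s t =>
    obtain ⟨F, hF, eF⟩ := h.exists_term s
    obtain ⟨G, hG, eG⟩ := h.exists_term t
    refine ⟨_, hF.eq hG, fun x => ?_⟩
    rw [eF, eG, ← Subtype.ext_iff]
    simp only [BoundedFormula.Realize, Sum.elim_comp_inl_inr]
  | rel R ts =>
    choose G hG e using fun i => h.exists_term (ts i)
    obtain ⟨P, hP, eP⟩ := h.relations R
    refine ⟨_, hP.subst hG, fun x => ?_⟩
    simp only [e, eP, BoundedFormula.Realize, Sum.elim_comp_inl_inr]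
  | imp φ ψ ihφ ihψ =>
    obtain ⟨P, hP, eP⟩ := ihφ
    obtain ⟨Q, hQ, eQ⟩ := ihψ
    exact ⟨_, hP.imp hQ, fun x => by rw [eP, eQ]; rfl⟩
  | @all n φ ih =>
    obtain ⟨P, hP, eP⟩ := ih
    have hA : Arithmetical fun v : α ⊕ Fin n → ℕ =>
        ∀ y, y ∈ D → P (Sum.elim (v ∘ Sum.inl) (Fin.snoc (v ∘ Sum.inr) y : Fin (n + 1) → ℕ)) := by
      refine .forall_nat (.imp (h.domain.reindex fun _ => none) ?_)
      refine (hP.reindex (Sum.elim (some ∘ Sum.inl)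
        (Fin.snoc (some ∘ Sum.inr) none : Fin (n + 1) → Option (α ⊕ Fin n)))).of_iff fun w => ?_
      rw [iff_iff_eq]
      congr 1
      funext a
      rcases a with a | i
      · rfl
      · refine Fin.lastCases ?_ (fun i => ?_) i <;> simp
    refine ⟨_, hA, fun x => ?_⟩
    simp only [BoundedFormula.Realize, Subtype.forall]
    refine forall₂_congr fun y hy => ?_
    have := eP (Sum.elim (x ∘ Sum.inl) (Fin.snoc (x ∘ Sum.inr) ⟨y, hy⟩ : Fin (n + 1) → D))
    rw [Sum.elim_comp_inl, Sum.elim_comp_inr] at this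
    rw [← this, iff_iff_eq]
    congr 1
    funext a
    rcases a with a | i
    · rfl
    · refine Fin.lastCases ?_ (fun i => ?_) i <;> simp

theorem exists_formula (h : IsArithmeticalStructure S) {α : Type} (φ : L.Formula α) :
    ∃ P : (α → ℕ) → Prop, Arithmetical P ∧ ∀ x : α → D, P (fun a => x a) ↔ φ.Realize x := by
  obtain ⟨P, hP, e⟩ := h.exists_boundedFormula φ
  refine ⟨_, hP.reindex (Sum.elim id Fin.elim0), fun x => ?_⟩
  have := e (Sum.elim x Fin.elim0)
  rw [Sum.elim_comp_inl] at this
  rw [Formula.Realize, ← Subsingleton.elim (Sum.elim x Fin.elim0 ∘ Sum.inr) default, ← this,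
    iff_iff_eq]
  congr 1
  funext a
  rcases a with a | i
  · rfl
  · exact i.elim0

/-- A structure each of whose functions and relations is defined by a formula of an arithmetical
structure on the same domain is arithmetical. -/
theorem of_definable {L' : FirstOrder.Language.{u₂, v₂}} {S' : L'.Structure D}
    (h : IsArithmeticalStructure S)
    (hf : ∀ {n : ℕ} (f : L'.Functions n), ∃ φ : L.Formula (Fin (n + 1)),
      ∀ (x : Fin n → D) (y : D), S'.funMap f x = y ↔ φ.Realize (Fin.cons y x : Fin (n + 1) → D))
    (hr : ∀ {n : ℕ} (R : L'.Relations n), ∃ φ : L.Formula (Fin n),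
      ∀ x : Fin n → D, S'.RelMap R x ↔ φ.Realize x) :
    IsArithmeticalStructure S' where
  domain := h.domain
  functions {n} f := by
    classical
    obtain ⟨φ, hφ⟩ := hf f
    obtain ⟨P, hP, eP⟩ := h.exists_formula φ
    -- The function is made total by the value `0` off `D`.
    have hA : Arithmetical fun w : Option (Fin n) → ℕ =>
        ((∀ i, w (some i) ∈ D) → w none ∈ D ∧ P (Fin.cons (w none) (w ∘ some) : Fin (n + 1) → ℕ)) ∧
        (¬ (∀ i, w (some i) ∈ D) → w none = 0) := by
      have hD : Arithmetical fun w : Option (Fin n) → ℕ => ∀ i, w (some i) ∈ D :=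
        .forall_finite fun i => h.domain.reindex fun _ => some i
      refine .and (hD.imp (.and (h.domain.reindex fun _ => none) ?_))
        (hD.not.imp (ArithmeticalFun.eq (.var none) .zero))
      refine (hP.reindex (Fin.cons none some : Fin (n + 1) → Option (Fin n))).of_iff fun w => ?_
      rw [iff_iff_eq]
      congr 1
      funext i
      refine Fin.cases ?_ (fun i => ?_) i <;> simp
    refine ⟨fun x => if hx : ∀ i, x i ∈ D then S'.funMap f fun i => ⟨x i, hx i⟩ else 0,
      hA.of_iff fun w => ?_, fun x => by simp⟩
    by_cases hw : ∀ i, w (some i) ∈ D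
    · have key : ∀ y : D, P (Fin.cons y (w ∘ some) : Fin (n + 1) → ℕ) ↔
          S'.funMap f (fun i => ⟨w (some i), hw i⟩) = y := fun y => by
        rw [hφ, ← eP, iff_iff_eq]
        congr 1
        funext i
        refine Fin.cases ?_ (fun i => ?_) i <;> simp
      simp only [Function.comp_apply, hw, implies_true, dite_true, forall_const, not_true_eq_false,
        false_imp_iff, and_true]
      constructor
      · intro e
        rw [e]
        exact ⟨Subtype.property _, (key _).2 rfl⟩
      · rintro ⟨hn, hp⟩
        rw [(key ⟨_, hn⟩).1 hp]
    · simp [hw]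
  relations R := by
    obtain ⟨φ, hφ⟩ := hr R
    obtain ⟨P, hP, eP⟩ := h.exists_formula φ
    exact ⟨P, hP, fun x => (eP x).trans (hφ x).symm⟩

end IsArithmeticalStructure

/-! ### Numerals in models of true arithmetic -/

/-- The numeral of a natural number. -/
def numeral : ℕ → arith.Term Empty
  | 0 => Term.func (L := arith) ArithFunc.zero Fin.elim0
  | n + 1 => Term.func (L := arith) ArithFunc.add
      ![numeral n, Term.func (L := arith) ArithFunc.one Fin.elim0]

theorem realize_numeral_nat (n : ℕ) (v : Empty → ℕ) : (numeral n).realize v = n := by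
  induction n with
  | zero => rfl
  | succ n ih => exact congrArg (· + 1) ih

/-- The value of a numeral in an arithmetical structure. -/
def numeralValue (N : Type) [arith.Structure N] (n : ℕ) : N :=
  (numeral n).realize (default : Empty → N)

section Elementary

variable {N : Type} [arith.Structure N]

/-- Substituting numerals yields a sentence, which transfers from `ℕ` to `N`; the converse uses the
negated formula. -/
theorem realize_numeralValue (hN : N ⊨ trueArithmetic) {α : Type} (φ : arith.Formula α)
    (v : α → ℕ) : φ.Realize (fun a => numeralValue N (v a)) ↔ φ.Realize v := by
  have key : ∀ (ψ : arith.Formula α), ψ.Realize v → ψ.Realize (fun a => numeralValue N (v a)) := by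
    intro ψ hψ
    have h : ℕ ⊨ (ψ.subst fun a => numeral (v a) : arith.Sentence) := by
      refine BoundedFormula.realize_subst.2 ?_
      simp only [realize_numeral_nat]
      exact hψ
    exact BoundedFormula.realize_subst.1 (hN.realize_of_mem _ h)
  refine ⟨fun h => ?_, key φ⟩
  by_contra hn
  exact key φ.not hn h

theorem realize_of_forall_nat (hN : N ⊨ trueArithmetic) {α : Type} [Finite α]
    {φ : arith.Formula α} (h : ∀ v : α → ℕ, φ.Realize v) (v : α → N) : φ.Realize v := by
  have h' : ℕ ⊨ ((φ.relabel Sum.inr : arith.Formula (Empty ⊕ α)).iAlls α : arith.Sentence) :=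
    Formula.realize_iAlls.2 fun x => Formula.realize_relabel.2 (h _)
  have := Formula.realize_iAlls.1 (hN.realize_of_mem _ h') v
  exact (Formula.realize_relabel (g := Sum.inr)).1 this

theorem nonempty_equiv_of_surjective (hN : N ⊨ trueArithmetic)
    (hs : Function.Surjective (numeralValue N)) : Nonempty (N ≃[arith] ℕ) := by
  let e : ℕ ↪ₑ[arith] N := ⟨numeralValue N, fun _ φ x => realize_numeralValue hN φ x⟩
  refine ⟨FirstOrder.Language.Equiv.symm ⟨Equiv.ofBijective e ⟨e.injective, hs⟩, ?_, ?_⟩⟩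
  · exact fun f x => e.map_fun f x
  · exact fun R => Empty.elim R

/-- For fixed `n`, true arithmetic says that every element is one of `0, …, n` or exceeds `n`. -/
theorem realize_numeralValue_lt (hN : N ⊨ trueArithmetic) {φ : arith.Formula (Fin 2)}
    (hφ : ∀ v : Fin 2 → ℕ, φ.Realize v ↔ v 0 < v 1) {b : N}
    (hb : b ∉ Set.range (numeralValue N)) (n : ℕ) : φ.Realize ![numeralValue N n, b] := by
  let ψ : arith.Formula Unit :=
    Formula.iSup (fun k : Fin (n + 1) =>
      (Term.var ()).equal ((numeral k).relabel Empty.elim)) ⊔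
    BoundedFormula.subst φ ![(numeral n).relabel Empty.elim, Term.var ()]
  have hψ : ∀ {K : Type} [arith.Structure K] (v : Unit → K), ψ.Realize v ↔
      (∃ k : Fin (n + 1), v () = numeralValue K k) ∨ φ.Realize ![numeralValue K n, v ()] := by
    intro K _ v
    refine BoundedFormula.realize_sup.trans (or_congr ?_ ?_)
    · refine Formula.realize_iSup.trans (exists_congr fun k => ?_)
      rw [Formula.realize_equal, Term.realize_relabel, numeralValue,
        Subsingleton.elim (v ∘ Empty.elim) default]
      rfl
    · refine BoundedFormula.realize_subst.trans ?_
      rw [Formula.Realize, iff_iff_eq]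
      congr 1
      funext a
      fin_cases a
      · simp [Term.realize_relabel, numeralValue, Subsingleton.elim (v ∘ Empty.elim) default]
      · rfl
  have h := realize_of_forall_nat hN (φ := ψ) (fun v => (hψ v).2 ?_) fun _ => b
  · refine ((hψ _).1 h).resolve_left ?_
    rintro ⟨k, hk⟩
    exact hb ⟨k, hk.symm⟩
  · simp only [numeralValue, realize_numeral_nat, hφ]
    by_cases hv : v () < n + 1
    · exact .inl ⟨⟨v (), hv⟩, rfl⟩
    · exact .inr (by simpa using hv)

end Elementary

/-! ### Coding of sets and the numeral map -/

/-- In a non-standard model of true arithmetic every arithmetical set is coded by an element, the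
coding being uniform. -/
theorem exists_uniform_coding : ∃ E : arith.Formula (Fin 2),
    ∀ {N : Type} [arith.Structure N], N ⊨ trueArithmetic →
      ¬ Function.Surjective (numeralValue N) → ∀ {P : ℕ → Prop},
        Arithmetical (fun v : Unit → ℕ => P (v ())) →
          ∃ a : N, ∀ n, E.Realize ![numeralValue N n, a] ↔ P n := by
  classical
  -- The code `v 1` contains `v 0` when the corresponding beta value is nonzero.
  have hE : Arithmetical fun v : Fin 2 → ℕ => ¬ Nat.beta (v 1) (v 0) = 0 := by
    have h (i : Fin 2) : Primrec fun v : Fin 2 → ℕ => v i := Primrec.fin_app.comp .id (.const i)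
    have hu : Primrec fun v : Fin 2 → ℕ => (v 1).unpair := Primrec.unpair.comp (h 1)
    refine (ArithmeticalFun.eq (.of_computable (Primrec.to_comp ?_)) .zero).not
    exact Primrec.nat_mod.comp (Primrec.fst.comp hu)
      (Primrec.succ.comp (Primrec.nat_mul.comp (Primrec.succ.comp (h 0)) (Primrec.snd.comp hu)))
  have hlt : Arithmetical fun v : Fin 2 → ℕ => v 0 < v 1 := ArithmeticalFun.lt (.var 0) (.var 1)
  obtain ⟨E, hE⟩ := hE
  obtain ⟨ρ, hρ⟩ := hlt
  refine ⟨E, fun {N} _ hN hs P ⟨φ, hφ⟩ => ?_⟩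
  obtain ⟨b, hb⟩ := not_forall.1 hs
  -- `ψ(c)` says that some `a` codes the set defined by `φ` below `c`. It holds for all `c` in `ℕ`,
  -- hence at the non-standard `b`, which lies above every numeral.
  let ψ : arith.Formula Unit := (((ρ.relabel ![Sum.inr (), Sum.inl (Sum.inl ())]).imp
    ((E.relabel ![Sum.inr (), Sum.inl (Sum.inr ())]).iff (φ.relabel Sum.inr))).iAlls Unit).iExs Unit
  have hψ : ∀ {K : Type} [arith.Structure K] (c : K), ψ.Realize (fun _ => c) ↔
      ∃ a, ∀ x, ρ.Realize ![x, c] → (E.Realize ![x, a] ↔ φ.Realize fun _ => x) := by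
    intro K _ c
    refine Formula.realize_iExs.trans ((Equiv.funUnique Unit K).exists_congr fun a => ?_)
    refine Formula.realize_iAlls.trans ((Equiv.funUnique Unit K).forall_congr fun x => ?_)
    rw [Formula.realize_imp, Formula.realize_iff, Formula.realize_relabel, Formula.realize_relabel,
      Formula.realize_relabel]
    have e₁ : Sum.elim (Sum.elim (fun _ : Unit => c) a) x ∘
        ![Sum.inr (), Sum.inl (Sum.inl ())] = ![Equiv.funUnique Unit K x, c] := by
      funext k; fin_cases k <;> rfl
    have e₂ : Sum.elim (Sum.elim (fun _ : Unit => c) a) x ∘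
        ![Sum.inr (), Sum.inl (Sum.inr ())] =
          ![Equiv.funUnique Unit K x, Equiv.funUnique Unit K a] := by
      funext k; fin_cases k <;> rfl
    rw [← e₁, ← e₂]
    rfl
  have hnat : ∀ v : Unit → ℕ, ψ.Realize v := by
    refine fun v => (hψ (v ())).2 ?_
    let l := (List.range (v ())).map fun x => if P x then 1 else 0
    refine ⟨Nat.unbeta l, fun x hx => ?_⟩
    replace hx : x < v () := (hρ _).1 hx
    have := Nat.beta_unbeta_coe l ⟨x, by simpa [l] using hx⟩
    simp only [l, List.getElem_map, List.getElem_range, Fin.getElem_fin] at this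
    rw [hE, hφ]
    simp [this, l]
  obtain ⟨a, ha⟩ := (hψ b).1 (realize_of_forall_nat hN hnat _)
  refine ⟨a, fun n => ?_⟩
  rw [ha _ (realize_numeralValue_lt hN hρ hb n), realize_numeralValue hN φ fun _ => n, hφ]

/-- Numerals arise from zero by iterating the structure's own arithmetical operation of adding one.
-/
theorem IsArithmeticalStructure.numeralValue {D : Set ℕ} [S : arith.Structure D]
    (h : IsArithmeticalStructure S) :
    ArithmeticalFun fun v : Unit → ℕ => (numeralValue D (v ()) : ℕ) := by
  obtain ⟨Z, hZ, eZ⟩ := h.functions ArithFunc.zero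
  obtain ⟨U, hU, eU⟩ := h.functions ArithFunc.one
  obtain ⟨A, hA, eA⟩ := h.functions ArithFunc.add
  have hg : ArithmeticalFun fun w : Option (Option Empty) → ℕ => A ![w none, U Fin.elim0] := by
    have := hA.comp (f := ![fun w : Option (Option Empty) → ℕ => w none, fun w => U Fin.elim0]) ?_
    · refine this.congr fun w => congrArg A (funext fun k => ?_)
      fin_cases k <;> rfl
    · intro k
      fin_cases k
      · exact .var none
      · exact (hU.reindex Fin.elim0).congr fun w => congrArg U (Subsingleton.elim _ _)
  have hz : ArithmeticalFun fun _ : Empty → ℕ => Z Fin.elim0 :=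
    (hZ.reindex Fin.elim0).congr fun w => congrArg Z (Subsingleton.elim _ _)
  have hr := ArithmeticalFun.natRec (g := fun _ _ y => A ![y, U Fin.elim0]) hz hg
  have key : ∀ n, (DefEquiv.numeralValue D n : ℕ) =
      Nat.rec (motive := fun _ => ℕ) (Z Fin.elim0) (fun _ y => A ![y, U Fin.elim0]) n := by
    intro n
    induction n with
    | zero =>
      refine Eq.trans ?_ ((eZ Fin.elim0).symm.trans (congrArg Z (Subsingleton.elim _ _)))
      exact congrArg (fun x => (S.funMap ArithFunc.zero x : ℕ)) (Subsingleton.elim _ _)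
    | succ n ih =>
      have e : U Fin.elim0 = (S.funMap ArithFunc.one Fin.elim0 : D) :=
        (congrArg U (Subsingleton.elim _ _)).trans (eU Fin.elim0)
      change _ = A ![Nat.rec (motive := fun _ => ℕ) (Z Fin.elim0)
        (fun _ y => A ![y, U Fin.elim0]) n, U Fin.elim0]
      rw [← ih, e]
      have e' := eA ![DefEquiv.numeralValue D n, S.funMap ArithFunc.one Fin.elim0]
      refine Eq.trans ?_ (e'.symm.trans (congrArg A ?_))
      · refine congrArg (fun x => (S.funMap ArithFunc.add x : ℕ)) (funext fun k => ?_)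
        fin_cases k
        · rfl
        · exact congrArg (S.funMap ArithFunc.one) (Subsingleton.elim _ _)
      · funext k
        fin_cases k <;> rfl
  exact (hr.reindex fun _ => ()).congr fun v => key (v ())

end DefEquiv

/-! ### The diagonal argument -/

open DefEquiv

theorem mainTheorem5
    {L : FirstOrder.Language.{u₁, v₁}} [Finite L.Symbols] (T : L.Theory)
    {L' : FirstOrder.Language.{u₂, v₂}} (i : L →ᴸ L') (j : DefEquiv.arith →ᴸ L') (V : L'.Theory)
    (hV : DefEquiv.IsJointDefinitionalExtension i j T DefEquiv.trueArithmetic V)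
    (D : Set ℕ) (M : L.Structure D) (hMT : D ⊨ T) (hM : DefEquiv.IsComputableStructure M)
    (M' : DefEquiv.arith.Structure D) (hMM' : DefEquiv.Corresponds i j V M M') :
    ¬ DefEquiv.IsNonstandard M' := by
  obtain ⟨S, hS, hi, hj⟩ := hMM'
  have : Nonempty D := ⟨M'.funMap ArithFunc.zero Fin.elim0⟩
  have hiS : i.IsExpansionOn D := by
    subst hi
    exact LHom.isExpansionOn_reduct i D
  have hjS : j.IsExpansionOn D := by
    subst hj
    exact LHom.isExpansionOn_reduct j D
  have hTA : D ⊨ trueArithmetic := (Theory.model_iff _).2 fun φ hφ =>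
    (j.realize_onSentence D φ).1 <| ((hV.right.conservative φ).2
      (Theory.models_sentence_of_mem hφ)).realize_sentence D
  have hA : IsArithmeticalStructure M' := by
    refine hM.isArithmeticalStructure.of_definable (fun {n} f => ?_) fun R => Empty.elim R
    obtain ⟨φ, hφ⟩ := hV.left.function_definable n (j.onFunction f)
    refine ⟨φ, fun x y => ?_⟩
    have h := hφ.realize_formula D (v := (Fin.cons y x : Fin (n + 1) → D))
    rw [Formula.realize_iff, Formula.realize_graph, LHom.realize_onFormula,
      LHom.map_onFunction] at h
    exact h
  intro hns
  obtain ⟨E, hE⟩ := exists_uniform_coding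
  obtain ⟨P, hP, eP⟩ := hA.exists_formula E
  -- `P` expresses `E` only on `D`; its values for `n` outside `D` are irrelevant, since only `n =
  -- a` is used below.
  have hd : Arithmetical fun v : Unit → ℕ => ¬ P ![(numeralValue D (v ()) : ℕ), v ()] := by
    have := hP.subst (f := ![fun v : Unit → ℕ => (numeralValue D (v ()) : ℕ), fun v => v ()]) ?_
    · refine this.not.of_iff fun v => not_congr (iff_of_eq (congrArg P (funext fun k => ?_)))
      fin_cases k <;> rfl
    · intro k
      fin_cases k
      exacts [hA.numeralValue, .var ()]
  obtain ⟨a, ha⟩ := hE hTA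
    (fun hs => (not_nonempty_iff.2 hns) (nonempty_equiv_of_surjective hTA hs))
    (P := fun n => ¬ P ![(numeralValue D n : ℕ), n]) hd
  -- The code `a` is used both as an element of `M'` and, by coercion, as the natural number whose
  -- numeral is tested.
  have e := (eP ![numeralValue D a, a]).trans (ha a)
  have e' : (fun k => ((![numeralValue D a, a] : Fin 2 → D) k : ℕ)) =
      ![(numeralValue D a : ℕ), (a : ℕ)] := by
    funext k; fin_cases k <;> rfl
  rw [e'] at e
  exact iff_not_self e
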